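/- All spaces are over $\mathbb{R}$. Let $E$ be a Banach lattice, and let its dual $E'$ carry the dual lattice order ($f\le g$ iff $f(x)\le g(x)$ for all $x\ge 0$). A sequence $(f_n)$ in $E'$ is disjoint if $|f_m|\wedge|f_n|=0$ for all $m\ne n$. A bounded operator $T\colon E\to c_0$ is called disjoint if there is a disjoint weak* null sequence $(f_n)$ in $E'$ with $T(x)=(f_n(x))_n$ for all $x\in E$. A set $A\subset E$ is called almost Grothendieck if $T(A)$ is relatively weakly compact in $c_0$ for every disjoint operator $T\colon E\to c_0$. A bounded operator $T\colon X\to E$, with $X$ a Banach space, is called almost Grothendieck if $T'f_n\to 0$ weakly in $X'$ for every disjoint weak* null sequence $(f_n)$ in $E'$. An operator is weakly compact if it maps the closed unit ball to a relatively weakly compact set. Theorem. For a Banach lattice $E$ the following assertions are equivalent: (1) every almost Grothendieck subset of $E$ is relatively weakly compact; (2) for every Banach space $X$, every almost Grothendieck operator $T\colon X\to E$ is weakly compact; (3) every almost Grothendieck operator $T\colon \ell_1\to E$ is weakly compact. -/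

import Mathlib

open Filter Topology
open scoped ZeroAtInfty

universe u v

/-! ### The dual Banach lattice

For a Banach lattice `E`, the dual `E'` is ordered by `f ≤ g` iff `f x ≤ g x` for all `x ≥ 0`.
By the Riesz–Kantorovich construction this order is a lattice. -/

namespace DualLattice

variable {E : Type u} [NormedAddCommGroup E] [NormedSpace ℝ E] [Lattice E]

/-- The supremum of `h` over the order interval `[0, x]`: for `x ≥ 0` this is the value at `x` of
the positive part of `h`. -/
noncomputable def posAux (h : StrongDual ℝ E) (x : E) : ℝ :=
  sSup (h '' Set.Icc 0 x)

theorem posAux_le (h : StrongDual ℝ E) {x : E} (hx : 0 ≤ x) {c : ℝ}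
    (hc : ∀ y, 0 ≤ y → y ≤ x → h y ≤ c) : posAux h x ≤ c := by
  refine csSup_le ⟨h 0, 0, ⟨le_rfl, hx⟩, rfl⟩ ?_
  rintro _ ⟨y, hy, rfl⟩
  exact hc y hy.1 hy.2

section

variable [HasSolidNorm E] [IsOrderedAddMonoid E]

theorem apply_le_of_mem (h : StrongDual ℝ E) {x y : E} (hy : y ∈ Set.Icc 0 x) :
    h y ≤ ‖h‖ * ‖x‖ := by
  have h1 : ‖y‖ ≤ ‖x‖ := by
    apply norm_le_norm_of_abs_le_abs
    rw [abs_of_nonneg hy.1, abs_of_nonneg (hy.1.trans hy.2)]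
    exact hy.2
  calc h y ≤ ‖h y‖ := le_abs_self _
    _ ≤ ‖h‖ * ‖y‖ := h.le_opNorm y
    _ ≤ ‖h‖ * ‖x‖ := by gcongr

theorem bddAbove_image (h : StrongDual ℝ E) (x : E) : BddAbove (h '' Set.Icc 0 x) := by
  refine ⟨‖h‖ * ‖x‖, ?_⟩
  rintro _ ⟨y, hy, rfl⟩
  exact apply_le_of_mem h hy

theorem le_posAux (h : StrongDual ℝ E) {x y : E} (h0 : 0 ≤ y) (hx : y ≤ x) : h y ≤ posAux h x :=
  le_csSup (bddAbove_image h x) ⟨y, ⟨h0, hx⟩, rfl⟩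

theorem posAux_nonneg (h : StrongDual ℝ E) {x : E} (hx : 0 ≤ x) : 0 ≤ posAux h x := by
  simpa using le_posAux h (le_refl (0 : E)) hx

theorem posAux_add (h : StrongDual ℝ E) {x z : E} (hx : 0 ≤ x) (hz : 0 ≤ z) :
    posAux h (x + z) = posAux h x + posAux h z := by
  apply le_antisymm
  · refine posAux_le h (add_nonneg hx hz) fun y h0 hy => ?_
    have e : h y = h (y ⊓ x) + h (y - y ⊓ x) := by rw [← map_add]; congr 1; abel
    rw [e]
    refine add_le_add (le_posAux h (le_inf h0 hx) inf_le_right)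
      (le_posAux h (sub_nonneg.2 inf_le_left) ?_)
    rw [sub_le_iff_le_add, add_inf]
    exact le_inf (le_add_of_nonneg_left hz) (by rwa [add_comm])
  · rw [← le_sub_iff_add_le]
    refine posAux_le h hx fun y h0 hy => ?_
    rw [le_sub_comm]
    refine posAux_le h hz fun w hw0 hw => ?_
    rw [le_sub_iff_add_le', ← map_add]
    exact le_posAux h (add_nonneg h0 hw0) (add_le_add hy hw)

/-- The positive part of a functional as an additive map, `x ↦ p x⁺ - p x⁻`. -/
noncomputable def posHom (h : StrongDual ℝ E) : E →+ ℝ :=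
  AddMonoidHom.mk' (fun x => posAux h x⁺ - posAux h x⁻) (by
    intro x z
    have e : (x + z)⁺ + (x⁻ + z⁻) = (x⁺ + z⁺) + (x + z)⁻ := by
      have h1 := posPart_sub_negPart (x + z)
      have h2 := posPart_sub_negPart x
      have h3 := posPart_sub_negPart z
      rw [sub_eq_iff_eq_add] at h1
      rw [h1]
      nth_rewrite 1 [← h2, ← h3]
      abel
    have e' := congrArg (posAux h) e
    have p := fun y : E => posPart_nonneg y
    have m := fun y : E => negPart_nonneg y
    rw [posAux_add h (p _) (add_nonneg (m _) (m _)), posAux_add h (m _) (m _),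
      posAux_add h (add_nonneg (p _) (p _)) (m _), posAux_add h (p _) (p _)] at e'
    linarith)

/-- The positive part `h⁺` of a continuous linear functional `h`, with
`h⁺ x = sup {h y : 0 ≤ y ≤ x}` for `x ≥ 0`. -/
noncomputable def pos (h : StrongDual ℝ E) : StrongDual ℝ E :=
  (posHom h).toRealLinearMap (by
    refine AddMonoidHomClass.continuous_of_bound (posHom h) ‖h‖ fun x => ?_
    have b : ∀ y : E, 0 ≤ y → |y| ≤ |x| → posAux h y ≤ ‖h‖ * ‖x‖ := fun y h0 hy =>
      (posAux_le h h0 fun w hw0 hw => apply_le_of_mem h ⟨hw0, hw⟩).trans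
        (mul_le_mul_of_nonneg_left (norm_le_norm_of_abs_le_abs hy) (norm_nonneg _))
    have b1 := b x⁺ (posPart_nonneg x) (by
      rw [abs_of_nonneg (posPart_nonneg x)]; exact sup_le (le_abs_self x) (abs_nonneg x))
    have b2 := b x⁻ (negPart_nonneg x) (by
      rw [abs_of_nonneg (negPart_nonneg x)]; exact sup_le (neg_le_abs x) (abs_nonneg x))
    have c1 := posAux_nonneg h (posPart_nonneg x)
    have c2 := posAux_nonneg h (negPart_nonneg x)
    change |posAux h x⁺ - posAux h x⁻| ≤ _
    rw [abs_le]
    constructor <;> linarith)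

theorem pos_apply (h : StrongDual ℝ E) {x : E} (hx : 0 ≤ x) : pos h x = posAux h x := by
  change posAux h x⁺ - posAux h x⁻ = _
  rw [posPart_of_nonneg hx, negPart_of_nonneg hx]
  have : posAux h (0 : E) = 0 := by simp [posAux]
  rw [this, sub_zero]

/-- The lattice structure of the dual of a normed lattice: `f ≤ g` iff `f x ≤ g x` for every
`x ≥ 0`. -/
noncomputable instance instLatticeDual : Lattice (StrongDual ℝ E) where
  le f g := ∀ x : E, 0 ≤ x → f x ≤ g x
  le_refl _ _ _ := le_rfl
  le_trans _ _ _ h1 h2 x hx := (h1 x hx).trans (h2 x hx)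
  le_antisymm f g h1 h2 := by
    ext x
    rw [← posPart_sub_negPart x, map_sub, map_sub,
      le_antisymm (h1 _ (posPart_nonneg x)) (h2 _ (posPart_nonneg x)),
      le_antisymm (h1 _ (negPart_nonneg x)) (h2 _ (negPart_nonneg x))]
  sup f g := g + pos (f - g)
  inf f g := f - pos (f - g)
  le_sup_left f g x hx := by
    have := le_posAux (f - g) hx le_rfl
    simp only [_root_.add_apply, _root_.sub_apply, pos_apply _ hx] at *
    linarith
  le_sup_right f g x hx := by
    have := posAux_nonneg (f - g) hx
    simp only [_root_.add_apply, pos_apply _ hx] at *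
    linarith
  sup_le f g k h1 h2 x hx := by
    have : posAux (f - g) x ≤ k x - g x := posAux_le _ hx fun y h0 hy => by
      have a := h1 y h0
      have b := h2 (x - y) (sub_nonneg.2 hy)
      simp only [_root_.sub_apply, map_sub] at *
      linarith
    simp only [_root_.add_apply, pos_apply _ hx]
    linarith
  inf_le_left f g x hx := by
    have := posAux_nonneg (f - g) hx
    simp only [_root_.sub_apply, pos_apply _ hx] at *
    linarith
  inf_le_right f g x hx := by
    have := le_posAux (f - g) hx le_rfl
    simp only [_root_.sub_apply, pos_apply _ hx] at *
    linarith
  le_inf k f g h1 h2 x hx := by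
    have : posAux (f - g) x ≤ f x - k x := posAux_le _ hx fun y h0 hy => by
      have a := h2 y h0
      have b := h1 (x - y) (sub_nonneg.2 hy)
      simp only [_root_.sub_apply, map_sub] at *
      linarith
    simp only [_root_.sub_apply, pos_apply _ hx]
    linarith

end

end DualLattice

/-! ### Weak and weak* notions in Banach spaces -/

section Weak

variable {X : Type u} [NormedAddCommGroup X] [NormedSpace ℝ X]
variable {Y : Type v} [NormedAddCommGroup Y] [NormedSpace ℝ Y]

/-- A subset of `X` is relatively weakly compact if its weak closure is weakly compact. -/
def IsRelativelyWeaklyCompact (A : Set X) : Prop :=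
  IsCompact (closure (toWeakSpace ℝ X '' A))

/-- A sequence in `X` is weakly null if it converges to `0` in the weak topology of `X`. -/
def IsWeaklyNull (x : ℕ → X) : Prop :=
  Tendsto (fun n => toWeakSpace ℝ X (x n)) atTop (𝓝 0)

/-- A sequence in `X'` is weak* null if it converges to `0` in the weak* topology. -/
def IsWeakStarNull (f : ℕ → StrongDual ℝ X) : Prop :=
  Tendsto (fun n => StrongDual.toWeakDual (f n)) atTop (𝓝 0)

/-- A bounded operator is weakly compact if it maps the closed unit ball onto a relatively weakly
compact set. -/
def IsWeaklyCompactOperator (T : X →L[ℝ] Y) : Prop :=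
  IsRelativelyWeaklyCompact (T '' Metric.closedBall 0 1)

end Weak

/-! ### Almost Grothendieck sets and operators -/

section AlmostGrothendieck

variable {E : Type u} [NormedAddCommGroup E] [NormedSpace ℝ E] [Lattice E] [HasSolidNorm E]
  [IsOrderedAddMonoid E]
variable {X : Type v} [NormedAddCommGroup X] [NormedSpace ℝ X]

/-- A sequence in the dual lattice `E'` is disjoint if `|f m| ⊓ |f n| = 0` whenever `m ≠ n`. -/
def IsDisjointSeq (f : ℕ → StrongDual ℝ E) : Prop :=
  ∀ m n, m ≠ n → |f m| ⊓ |f n| = 0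

/-- An operator `T : E → c₀` is disjoint if `T x = (f n x)ₙ` for a disjoint weak* null sequence
`f` in `E'`. Here `c₀` is `C₀(ℕ, ℝ)` with the supremum norm. -/
def IsDisjointOperator (T : E →L[ℝ] C₀(ℕ, ℝ)) : Prop :=
  ∃ f : ℕ → StrongDual ℝ E, IsWeakStarNull f ∧ IsDisjointSeq f ∧ ∀ x n, T x n = f n x

/-- `A ⊆ E` is almost Grothendieck if `T(A)` is relatively weakly compact in `c₀` for every
disjoint operator `T : E → c₀`. -/
def IsAlmostGrothendieckSet (A : Set E) : Prop :=
  ∀ T : E →L[ℝ] C₀(ℕ, ℝ), IsDisjointOperator T → IsRelativelyWeaklyCompact (T '' A)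

/-- A bounded operator `T : X → E` is almost Grothendieck if `T' fₙ = fₙ ∘ T` is weakly null in
`X'` for every disjoint weak* null sequence `(fₙ)` in `E'`. -/
def IsAlmostGrothendieckOperator (T : X →L[ℝ] E) : Prop :=
  ∀ f : ℕ → StrongDual ℝ E, IsWeakStarNull f → IsDisjointSeq f →
    IsWeaklyNull fun n => (f n).comp T

end AlmostGrothendieck

/-! ### Weak topologies and the Eberlein–Šmulian theorem. -/

section WeakTopology

variable {X : Type u} [NormedAddCommGroup X] [NormedSpace ℝ X]

/-! Sets and operators are linked by two facts about a disjoint operator `S : E → c₀` with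
coordinates `f n`. If `T' f n` is weakly null, then `S ∘ T` is weakly compact, because its biadjoint
still takes values in `c₀` (`isWeaklyCompactOperator_of_isWeaklyNull`). So an almost Grothendieck
operator maps the unit ball to an almost Grothendieck set, which gives 1 → 2. Conversely, take a
sequence `a n` in an almost Grothendieck set `A` and let `T : ℓ₁ → E` send the unit vectors to it.
On the weakly compact closure `K` of `S(A)`, the coordinates of `c₀` are bounded, continuous and
pointwise null, hence weakly null in `C(K)` by Riesz representation and dominated convergence. A
bounded operator `C(K) → ℓ₁'` carries them to `T' f n`, so `T` is almost Grothendieck. Under 3, `T`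
is weakly compact, so `a n` has a weak cluster point, and Eberlein–Šmulian yields 1. -/

theorem isWeaklyNull_iff {x : ℕ → X} :
    IsWeaklyNull x ↔ ∀ φ : StrongDual ℝ X, Tendsto (fun n => φ (x n)) atTop (𝓝 0) := by
  rw [IsWeaklyNull,
    (NormedSpace.isEmbedding_inclusionInDoubleDualWeak ℝ X).tendsto_nhds_iff, map_zero]
  exact tendsto_iff_forall_eval_tendsto_topDualPairing

theorem isWeakStarNull_iff {f : ℕ → StrongDual ℝ X} :
    IsWeakStarNull f ↔ ∀ x : X, Tendsto (fun n => f n x) atTop (𝓝 0) :=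
  tendsto_iff_forall_eval_tendsto_topDualPairing

theorem continuous_weakSpace_apply (φ : StrongDual ℝ X) :
    Continuous fun x : WeakSpace ℝ X => φ ((toWeakSpace ℝ X).symm x) :=
  WeakBilin.eval_continuous (topDualPairing ℝ X).flip φ

theorem IsRelativelyWeaklyCompact.mono {A B : Set X} (hA : IsRelativelyWeaklyCompact A)
    (h : B ⊆ A) : IsRelativelyWeaklyCompact B :=
  hA.of_isClosed_subset isClosed_closure (closure_mono (Set.image_mono h))

theorem IsRelativelyWeaklyCompact.of_subset_isCompact {A : Set X} {K : Set (WeakSpace ℝ X)}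
    (hK : IsCompact K) (h : toWeakSpace ℝ X '' A ⊆ K) : IsRelativelyWeaklyCompact A :=
  hK.closure_of_subset h

theorem IsRelativelyWeaklyCompact.bddAbove_norm_apply {A : Set X} (hA : IsRelativelyWeaklyCompact A)
    (φ : StrongDual ℝ X) : BddAbove ((fun x => ‖φ x‖) '' A) := by
  refine (IsCompact.bddAbove_image hA (continuous_weakSpace_apply φ).norm.continuousOn).mono ?_
  rintro _ ⟨x, hx, rfl⟩
  exact ⟨toWeakSpace ℝ X x, subset_closure ⟨x, hx, rfl⟩, rfl⟩

/-- Weakly bounded sets are norm bounded. -/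
theorem isBounded_of_forall_bddAbove {A : Set X}
    (h : ∀ φ : StrongDual ℝ X, BddAbove ((fun x => ‖φ x‖) '' A)) : Bornology.IsBounded A := by
  obtain ⟨C, hC⟩ := banach_steinhaus
    (g := fun a : A => NormedSpace.inclusionInDoubleDual ℝ X (a : X)) (fun φ => by
      obtain ⟨C, hC⟩ := h φ
      exact ⟨C, fun a => hC ⟨a, a.2, rfl⟩⟩)
  refine isBounded_iff_forall_norm_le.2 ⟨C, fun x hx => ?_⟩
  have := hC ⟨x, hx⟩
  rwa [← (NormedSpace.inclusionInDoubleDualLi (E := X) ℝ).norm_map x]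

/-- Given a norming family of functionals, a finite-dimensional subspace is normed up to a factor `2`
by finitely many of them. -/
theorem exists_finset_norming {Z : Type u} [NormedAddCommGroup Z] [NormedSpace ℝ Z] {ι : Type v}
    {e : ι → StrongDual ℝ Z} (he : ∀ (v : Z) (r : ℝ), r < ‖v‖ → ∃ i, r < ‖e i v‖)
    (F : Submodule ℝ Z) [FiniteDimensional ℝ F] :
    ∃ N : Finset ι, ∀ v ∈ F, v ≠ 0 → ∃ i ∈ N, ‖v‖ ≤ 2 * ‖e i v‖ := by
  have hc : IsCompact (Metric.sphere (0 : F) 1) :=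
    haveI : ProperSpace F := FiniteDimensional.proper ℝ F
    isCompact_sphere 0 1
  obtain ⟨t, ht⟩ := hc.elim_finite_subcover
    (fun i => {v : F | 1 / 2 < ‖e i v‖})
    (fun i => isOpen_lt continuous_const (by fun_prop))
    (fun v hv => by
      have hv1 : ‖(v : Z)‖ = 1 := mem_sphere_zero_iff_norm.1 hv
      exact Set.mem_iUnion.2 (he v (1 / 2) (by rw [hv1]; norm_num)))
  refine ⟨t, fun v hv h0 => ?_⟩
  have hn : 0 < ‖v‖ := norm_pos_iff.2 h0
  have hs : (‖v‖⁻¹ • (⟨v, hv⟩ : F)) ∈ Metric.sphere (0 : F) 1 := by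
    refine mem_sphere_zero_iff_norm.2 ?_
    rw [norm_smul, norm_inv, norm_norm]
    exact inv_mul_cancel₀ hn.ne'
  obtain ⟨i, hit, hi⟩ := Set.mem_iUnion₂.1 (ht hs)
  refine ⟨i, hit, ?_⟩
  have h2 : 1 / 2 < ‖v‖⁻¹ * ‖e i v‖ := by simpa [norm_smul] using hi
  rw [inv_mul_eq_div, lt_div_iff₀ hn] at h2
  linarith

theorem exists_approx_of_mem_closure {A : Set X} {z : WeakDual ℝ (StrongDual ℝ X)}
    (hz : z ∈ closure (NormedSpace.inclusionInDoubleDualWeak ℝ X '' (toWeakSpace ℝ X '' A)))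
    (N : Finset (StrongDual ℝ X)) {ε : ℝ} (hε : 0 < ε) :
    ∃ a ∈ A, ∀ φ ∈ N, |z φ - φ a| < ε := by
  have ho : IsOpen {w : WeakDual ℝ (StrongDual ℝ X) | ∀ φ ∈ N, |z φ - w φ| < ε} := by
    simp only [Set.ofPred_forall]
    exact isOpen_biInter_finset fun φ _ => isOpen_lt
      (continuous_const.sub (WeakDual.eval_continuous φ)).abs continuous_const
  obtain ⟨_, hw, _, ⟨a, ha, rfl⟩, rfl⟩ := mem_closure_iff.1 hz _ ho (fun φ _ => by simpa using hε)
  exact ⟨a, ha, hw⟩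

/-- The main step of Whitley's proof of the Eberlein–Šmulian theorem. -/
theorem mem_range_of_mapClusterPt {Z : Type u} [NormedAddCommGroup Z] [NormedSpace ℝ Z]
    {ι : Type v} {e : ι → StrongDual ℝ Z}
    (he : ∀ (v : Z) (r : ℝ), r < ‖v‖ → ∃ i, r < ‖e i v‖) (he1 : ∀ i v, ‖e i v‖ ≤ ‖v‖)
    (J : X →L[ℝ] Z) {A : Set X} {z : Z}
    (hz : ∀ (N : Finset ι) (ε : ℝ), 0 < ε → ∃ a ∈ A, ∀ i ∈ N, |e i z - e i (J a)| < ε)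
    (hA : ∀ a : ℕ → X, (∀ n, a n ∈ A) →
      ∃ y : X, MapClusterPt (toWeakSpace ℝ X y) atTop fun n => toWeakSpace ℝ X (a n)) :
    ∃ y, J y = z := by
  classical
  let F : Finset X → Submodule ℝ Z := fun S =>
    Submodule.span ℝ ((insert z (S.image J) : Finset Z) : Set Z)
  choose N hN using fun S => exists_finset_norming he (F S)
  -- Taking all subsets of `S` lets the `n`-th choice serve the norming sets of every earlier stage
  -- as well.
  choose pick hpA hp using fun (S : Finset X) (n : ℕ) =>
    hz (S.powerset.biUnion N) _ (Nat.one_div_pos_of_nat (α := ℝ) (n := n))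
  let S : ℕ → Finset X := fun n => Nat.rec ∅ (fun k T => insert (pick T k) T) n
  have hS : ∀ n, S (n + 1) = insert (pick (S n) n) (S n) := fun n => rfl
  have hmono : Monotone S := monotone_nat_of_le_succ fun n => by
    rw [hS]; exact Finset.subset_insert _ _
  let a : ℕ → X := fun n => pick (S n) n
  have haS : ∀ n, a n ∈ S (n + 1) := fun n => by rw [hS]; exact Finset.mem_insert_self _ _
  have hclose : ∀ m n, m ≤ n → ∀ i ∈ N (S m), |e i z - e i (J (a n))| < 1 / ((n : ℝ) + 1) :=
    fun m n hmn i hi => hp (S n) n i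
      (Finset.mem_biUnion.2 ⟨S m, Finset.mem_powerset.2 (hmono hmn), hi⟩)
  obtain ⟨y, hy⟩ := hA a fun n => hpA _ _
  refine ⟨y, ?_⟩
  -- Mazur: a convex set has the same weak and norm closure.
  have hyspan : y ∈ closure (Submodule.span ℝ (Set.range a) : Set X) := by
    have h1 : toWeakSpace ℝ X y ∈
        closure (toWeakSpace ℝ X '' (Submodule.span ℝ (Set.range a) : Set X)) :=
      mem_closure_iff_clusterPt.2 (hy.clusterPt.mono (tendsto_principal.2 (Eventually.of_forall
        fun n => ⟨a n, Submodule.subset_span ⟨n, rfl⟩, rfl⟩)))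
    rw [← (Submodule.convex _).toWeakSpace_closure ℝ] at h1
    obtain ⟨y', hy', h⟩ := h1
    rwa [← (toWeakSpace ℝ X).injective h]
  -- The scalars `e i (J (a n))` converge to `e i z` and cluster at `e i (J y)`.
  have hvanish : ∀ m, ∀ i ∈ N (S m), e i z = e i (J y) := by
    intro m i hi
    have h1 : MapClusterPt (e i (J y)) atTop fun n => e i (J (a n)) :=
      MapClusterPt.continuousAt_comp
        (f := fun x : WeakSpace ℝ X => ((e i).comp J) ((toWeakSpace ℝ X).symm x))
        (continuous_weakSpace_apply ((e i).comp J)).continuousAt hy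
    have h2 : Tendsto (fun n => e i (J (a n))) atTop (𝓝 (e i z)) := by
      rw [tendsto_iff_dist_tendsto_zero]
      refine squeeze_zero' (Eventually.of_forall fun _ => dist_nonneg) ?_
        tendsto_one_div_add_atTop_nhds_zero_nat
      filter_upwards [eventually_ge_atTop m] with n hn
      rw [dist_comm, Real.dist_eq]
      exact (hclose m n hn i hi).le
    exact (eq_of_nhds_neBot (ClusterPt.mono h1.clusterPt h2)).symm
  have hFm : ∀ {m n}, m ≤ n → F (S m) ≤ F (S n) := fun h => Submodule.span_mono (by
    exact_mod_cast Finset.insert_subset_insert _ (Finset.image_subset_image (hmono h)))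
  have hspan : ∀ x ∈ Submodule.span ℝ (Set.range a), ∃ m, J x ∈ F (S m) := by
    intro x hx
    induction hx using Submodule.span_induction with
    | mem x hx =>
      obtain ⟨n, rfl⟩ := hx
      exact ⟨n + 1, Submodule.subset_span (by
        simp only [Finset.coe_insert, Finset.coe_image]
        exact Or.inr ⟨_, haS n, rfl⟩)⟩
    | zero => exact ⟨0, by simp⟩
    | add x x' _ _ hx hx' =>
      obtain ⟨m, hm⟩ := hx
      obtain ⟨n, hn⟩ := hx'
      refine ⟨max m n, ?_⟩
      rw [map_add]
      exact add_mem (hFm (le_max_left _ _) hm) (hFm (le_max_right _ _) hn)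
    | smul c x _ hx =>
      obtain ⟨m, hm⟩ := hx
      exact ⟨m, by rw [map_smul]; exact Submodule.smul_mem _ _ hm⟩
  -- The constant is 2 from the norming functionals, which do not separate `z` from `J y`, plus 1
  -- from the triangle inequality.
  have hzero : ∀ x ∈ Submodule.span ℝ (Set.range a), ‖z - J y‖ ≤ 3 * ‖J x - J y‖ := by
    intro x hx
    obtain ⟨m, hm⟩ := hspan x hx
    have hm' : z - J x ∈ F (S m) := sub_mem (Submodule.subset_span (by simp)) hm
    have hx0 : ‖z - J x‖ ≤ 2 * ‖J x - J y‖ := by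
      by_cases h0 : z - J x = 0
      · rw [h0, norm_zero]; positivity
      obtain ⟨i, hi, h⟩ := hN (S m) _ hm' h0
      have h1 : e i (z - J x) = - e i (J x - J y) := by
        rw [map_sub, map_sub, hvanish m i hi]; ring
      rw [h1, norm_neg] at h
      linarith [he1 i (J x - J y)]
    calc ‖z - J y‖ = ‖(z - J x) + (J x - J y)‖ := by rw [sub_add_sub_cancel]
      _ ≤ ‖z - J x‖ + ‖J x - J y‖ := norm_add_le _ _
      _ ≤ 3 * ‖J x - J y‖ := by linarith
  have hle : ‖z - J y‖ ≤ 3 * ‖J y - J y‖ :=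
    (closure_minimal (s := (Submodule.span ℝ (Set.range a) : Set X))
      (t := {x | ‖z - J y‖ ≤ 3 * ‖J x - J y‖}) hzero
      (isClosed_le continuous_const (by fun_prop))) hyspan
  rw [sub_self, norm_zero, mul_zero] at hle
  exact (sub_eq_zero.1 (norm_le_zero_iff.1 hle)).symm

/-- The Eberlein–Šmulian theorem: a bounded set in which every sequence has a weak cluster point
is relatively weakly compact. -/
theorem isRelativelyWeaklyCompact_of_mapClusterPt {A : Set X} (hb : Bornology.IsBounded A)
    (hA : ∀ a : ℕ → X, (∀ n, a n ∈ A) →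
      ∃ y : X, MapClusterPt (toWeakSpace ℝ X y) atTop fun n => toWeakSpace ℝ X (a n)) :
    IsRelativelyWeaklyCompact A := by
  -- It remains to show that the weak* closure of `A` in the bidual stays in `X`; the unit ball of
  -- `X'` is the norming family.
  refine NormedSpace.isCompact_closure_of_isBounded ℝ X (toWeakSpace ℝ X '' A) (by
    rwa [(toWeakSpace ℝ X).injective.preimage_image]) fun z hz => ?_
  obtain ⟨y, hy⟩ := mem_range_of_mapClusterPt (Z := StrongDual ℝ (StrongDual ℝ X))
    (ι := Metric.closedBall (0 : StrongDual ℝ X) 1)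
    (e := fun φ => NormedSpace.inclusionInDoubleDual ℝ (StrongDual ℝ X) φ)
    (fun v r hr => by
      obtain ⟨φ, hφ, h⟩ := v.exists_lt_apply_of_lt_opNorm hr
      exact ⟨⟨φ, mem_closedBall_zero_iff.2 hφ.le⟩, h⟩)
    (fun φ v => v.unit_le_opNorm _ (mem_closedBall_zero_iff.1 φ.2))
    (NormedSpace.inclusionInDoubleDual ℝ X) (z := WeakDual.toStrongDual z)
    (fun N ε hε => by
      classical
      obtain ⟨a, ha, h⟩ := exists_approx_of_mem_closure hz (N.image Subtype.val) hε
      exact ⟨a, ha, fun i hi => h i (Finset.mem_image_of_mem _ hi)⟩) hA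
  exact ⟨toWeakSpace ℝ X y, hy⟩

end WeakTopology

/-! ### Unit vectors of `c₀` and its functionals. -/

namespace ZeroAtInftyContinuousMap

/-- The `n`-th unit vector of `c₀`. -/
noncomputable def unitVector (n : ℕ) : C₀(ℕ, ℝ) where
  toFun := Pi.single n 1
  continuous_toFun := continuous_of_discreteTopology
  zero_at_infty' := by
    rw [cocompact_eq_cofinite, Nat.cofinite_eq_atTop]
    refine tendsto_const_nhds.congr' ?_
    filter_upwards [eventually_gt_atTop n] with k hk
    simp [hk.ne']

theorem unitVector_apply (n k : ℕ) : unitVector n k = Pi.single (M := fun _ => ℝ) n 1 k := rfl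

theorem norm_apply_le (c : C₀(ℕ, ℝ)) (n : ℕ) : ‖c n‖ ≤ ‖c‖ := by
  rw [← norm_toBCF_eq_norm]
  exact c.toBCF.norm_coe_le_norm n

theorem norm_le_of_forall {c : C₀(ℕ, ℝ)} {M : ℝ} (hM : 0 ≤ M) (h : ∀ n, ‖c n‖ ≤ M) : ‖c‖ ≤ M := by
  rw [← norm_toBCF_eq_norm]
  exact (BoundedContinuousFunction.norm_le hM).2 h

theorem sum_smul_unitVector_apply (s : Finset ℕ) (a : ℕ → ℝ) (n : ℕ) :
    (∑ i ∈ s, a i • unitVector i) n = if n ∈ s then a n else 0 := by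
  have h : (∑ i ∈ s, a i • unitVector i) n = ∑ i ∈ s, (a i • unitVector i) n := by
    classical
    induction s using Finset.induction_on with
    | empty => simp
    | insert i s hi ih => rw [Finset.sum_insert hi, Finset.sum_insert hi, add_apply, ih]
  rw [h]
  simp [unitVector_apply, Pi.single_apply]

theorem hasSum_smul_unitVector (c : C₀(ℕ, ℝ)) : HasSum (fun n => c n • unitVector n) c := by
  refine Metric.tendsto_atTop.2 fun ε hε => ?_
  have hc : Tendsto c atTop (𝓝 0) := by
    rw [← Nat.cofinite_eq_atTop, ← cocompact_eq_cofinite]; exact c.zero_at_infty'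
  obtain ⟨N, hN⟩ := Metric.tendsto_atTop.1 hc (ε / 2) (by positivity)
  refine ⟨Finset.range N, fun s hs => ?_⟩
  rw [dist_eq_norm]
  refine (norm_le_of_forall (M := ε / 2) (by positivity) fun n => ?_).trans_lt (by linarith)
  rw [sub_apply, sum_smul_unitVector_apply]
  split_ifs with h
  · simp; positivity
  · have : N ≤ n := not_lt.1 fun h' => h (hs (Finset.mem_range.2 h'))
    simpa using (hN n this).le

/-- Testing `φ` on finite sign vectors, which have norm at most 1, bounds all partial sums by `‖φ‖`.
-/
theorem summable_norm_apply_unitVector (φ : StrongDual ℝ C₀(ℕ, ℝ)) :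
    Summable fun n => ‖φ (unitVector n)‖ := by
  refine summable_of_sum_le (c := ‖φ‖) (fun _ => norm_nonneg _) fun s => ?_
  have h : ∑ n ∈ s, ‖φ (unitVector n)‖ =
      φ (∑ n ∈ s, (SignType.sign (φ (unitVector n)) : ℝ) • unitVector n) := by
    simp [map_sum, sign_mul_self]
  rw [h]
  refine (le_abs_self _).trans (φ.le_of_opNorm_le_of_le le_rfl
    (norm_le_of_forall (M := 1) zero_le_one fun n => ?_) |>.trans (mul_one _).le)
  rw [sum_smul_unitVector_apply]
  split_ifs
  · rcases SignType.trichotomy (SignType.sign (φ (unitVector n))) with h | h | h <;> simp [h]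
  · simp

end ZeroAtInftyContinuousMap

open ZeroAtInftyContinuousMap

/-! ### Operators into `c₀`. -/

section

variable {X : Type u} [NormedAddCommGroup X] [NormedSpace ℝ X]

/-- An operator into `c₀` whose coordinate functionals form a weakly null sequence is weakly
compact. -/
theorem isWeaklyCompactOperator_of_isWeaklyNull {R : X →L[ℝ] C₀(ℕ, ℝ)} {g : ℕ → StrongDual ℝ X}
    (hR : ∀ x n, R x n = g n x) (hg : IsWeaklyNull g) : IsWeaklyCompactOperator R := by
  rw [isWeaklyNull_iff] at hg
  -- This is the biadjoint of `R`; weak nullity of `g` is what puts its values in `c₀`.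
  let Ψ : WeakDual ℝ (StrongDual ℝ X) → C₀(ℕ, ℝ) := fun z =>
    { toFun := fun n => z (g n)
      continuous_toFun := continuous_of_discreteTopology
      zero_at_infty' := by
        rw [cocompact_eq_cofinite, Nat.cofinite_eq_atTop]
        exact hg (WeakDual.toStrongDual z) }
  have hgn : ∀ n, ‖g n‖ ≤ ‖R‖ := fun n => (g n).opNorm_le_bound R.opNorm_nonneg fun x => by
    rw [← hR]; exact (norm_apply_le _ _).trans (R.le_opNorm x)
  -- The series for `R' φ` converges in norm, so every `z` in the bidual may be applied termwise.
  -- This makes `Ψ` weak*-to-weak continuous, and Banach–Alaoglu applies.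
  have hsum : ∀ φ : StrongDual ℝ C₀(ℕ, ℝ),
      HasSum (fun n => φ (unitVector n) • g n) (φ.comp R) := by
    intro φ
    have hs : Summable fun n => φ (unitVector n) • g n :=
      Summable.of_norm_bounded ((summable_norm_apply_unitVector φ).mul_right ‖R‖) fun n => by
        rw [norm_smul]; gcongr; exact hgn n
    convert hs.hasSum using 1
    ext x
    have h1 := (ContinuousLinearMap.apply ℝ ℝ x).hasSum hs.hasSum
    have h2 := φ.hasSum (hasSum_smul_unitVector (R x))
    refine h2.unique (Eq.mp ?_ h1)
    congr 1
    ext n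
    simp [hR, mul_comm]
  have hφ : ∀ (φ : StrongDual ℝ C₀(ℕ, ℝ)) (z : WeakDual ℝ (StrongDual ℝ X)),
      φ (Ψ z) = z (φ.comp R) := by
    intro φ z
    have h1 := φ.hasSum (hasSum_smul_unitVector (Ψ z))
    have h2 := (WeakDual.toStrongDual z).hasSum (hsum φ)
    refine h1.unique (Eq.mp ?_ h2)
    congr 1
    ext n
    simp [Ψ, mul_comm]
  have hΨ : Continuous fun z => toWeakSpace ℝ C₀(ℕ, ℝ) (Ψ z) :=
    WeakBilin.continuous_of_continuous_eval _ fun φ =>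
      (WeakDual.eval_continuous (φ.comp R)).congr fun z => (hφ φ z).symm
  refine IsRelativelyWeaklyCompact.of_subset_isCompact
    ((WeakDual.isCompact_closedBall (𝕜 := ℝ) (0 : StrongDual ℝ (StrongDual ℝ X)) 1).image hΨ) ?_
  rintro _ ⟨_, ⟨x, hx, rfl⟩, rfl⟩
  refine ⟨StrongDual.toWeakDual (NormedSpace.inclusionInDoubleDual ℝ X x), ?_, ?_⟩
  · have : ‖NormedSpace.inclusionInDoubleDual ℝ X x‖ ≤ 1 :=
      (NormedSpace.double_dual_bound ℝ X x).trans (mem_closedBall_zero_iff.1 hx)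
    simpa using this
  · refine congrArg (toWeakSpace ℝ C₀(ℕ, ℝ)) (ZeroAtInftyContinuousMap.ext fun n => ?_)
    exact (hR x n).symm

/-- The operator into `c₀` with a given weak* null sequence of coordinate functionals. -/
theorem exists_operator_of_isWeakStarNull [CompleteSpace X] {f : ℕ → StrongDual ℝ X}
    (hf : IsWeakStarNull f) : ∃ S : X →L[ℝ] C₀(ℕ, ℝ), ∀ x n, S x n = f n x := by
  rw [isWeakStarNull_iff] at hf
  obtain ⟨C, hC⟩ := banach_steinhaus (g := f) fun x => by
    obtain ⟨C, hC⟩ := (hf x).norm.bddAbove_range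
    exact ⟨C, fun n => hC ⟨n, rfl⟩⟩
  let S : X →ₗ[ℝ] C₀(ℕ, ℝ) :=
    { toFun := fun x =>
        { toFun := fun n => f n x
          continuous_toFun := continuous_of_discreteTopology
          zero_at_infty' := by rw [cocompact_eq_cofinite, Nat.cofinite_eq_atTop]; exact hf x }
      map_add' := fun x y => by ext n; exact map_add (f n) x y
      map_smul' := fun c x => by ext n; exact map_smul (f n) c x }
  refine ⟨S.mkContinuous C fun x => norm_le_of_forall ?_ fun n => (f n).le_of_opNorm_le (hC n) x,
    fun x n => rfl⟩
  exact mul_nonneg ((norm_nonneg _).trans (hC 0)) (norm_nonneg _)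

end

/-! ### Weakly null sequences in `C(K)`. -/

section

open MeasureTheory CompactlySupported BoundedContinuousFunction

variable {K : Type u} [TopologicalSpace K] [CompactSpace K] [T2Space K]

/-- By Riesz–Markov–Kakutani, `Λ` is integration against a finite measure, and the constant `C`
dominates. -/
theorem tendsto_apply_of_pointwise_of_nonneg {Λ : StrongDual ℝ (K →ᵇ ℝ)}
    (hΛ : ∀ h : K →ᵇ ℝ, 0 ≤ h → 0 ≤ Λ h) {g : ℕ → K →ᵇ ℝ} {C : ℝ} (hC : ∀ n, ‖g n‖ ≤ C)
    (hg : ∀ p, Tendsto (fun n => g n p) atTop (𝓝 0)) :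
    Tendsto (fun n => Λ (g n)) atTop (𝓝 0) := by
  borelize K
  let Λ' : C_c(K, ℝ) →ₚ[ℝ] ℝ := PositiveLinearMap.mk₀
    { toFun := fun h => Λ (mkOfCompact h.toContinuousMap)
      map_add' := fun h k => by rw [← map_add]; rfl
      map_smul' := fun c h => by rw [RingHom.id_apply, ← map_smul]; rfl } fun h hh => hΛ _ hh
  have hint : ∀ n, ∫ p, g n p ∂(RealRMK.rieszMeasure Λ') = Λ (g n) := fun n => by
    refine (RealRMK.integral_rieszMeasure Λ'
      (CompactlySupportedContinuousMap.continuousMapEquiv (g n).toContinuousMap)).trans ?_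
    change Λ _ = Λ _
    congr 1
  simp_rw [← hint]
  rw [← integral_zero K ℝ (μ := RealRMK.rieszMeasure Λ')]
  exact tendsto_integral_of_dominated_convergence (fun _ => C)
    (fun n => (g n).continuous.aestronglyMeasurable) (integrable_const _)
    (fun n => Eventually.of_forall fun p => ((g n).norm_coe_le_norm p).trans (hC n))
    (Eventually.of_forall hg)

/-- A bounded pointwise null sequence of continuous functions on a compact space is weakly null. -/
theorem isWeaklyNull_of_pointwise {g : ℕ → K →ᵇ ℝ} {C : ℝ} (hC : ∀ n, ‖g n‖ ≤ C)
    (hg : ∀ p, Tendsto (fun n => g n p) atTop (𝓝 0)) : IsWeaklyNull g := by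
  refine isWeaklyNull_iff.2 fun Λ => ?_
  -- `Λ` is the difference of the positive functionals `Λ⁺` and `Λ⁺ - Λ`.
  have h1 := tendsto_apply_of_pointwise_of_nonneg (Λ := DualLattice.pos Λ) (fun h hh => by
    rw [DualLattice.pos_apply _ hh]; exact DualLattice.posAux_nonneg Λ hh) hC hg
  have h2 := tendsto_apply_of_pointwise_of_nonneg (Λ := DualLattice.pos Λ - Λ) (fun h hh => by
    rw [_root_.sub_apply, DualLattice.pos_apply _ hh, sub_nonneg]
    exact DualLattice.le_posAux Λ hh le_rfl) hC hg
  simpa using h1.sub h2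

end

/-! ### Operators on `ℓ₁`. -/

section

/-- The operator on `ℓ₁` sending the unit vectors to a given bounded sequence. -/
theorem exists_operator_lp_one {Y : Type u} [NormedAddCommGroup Y] [NormedSpace ℝ Y]
    [CompleteSpace Y] {y : ℕ → Y} {C : ℝ} (hy : ∀ n, ‖y n‖ ≤ C) :
    ∃ T : lp (fun _ : ℕ => ℝ) 1 →L[ℝ] Y, ∀ a, HasSum (fun n => a n • y n) (T a) := by
  have hs : ∀ a : lp (fun _ : ℕ => ℝ) 1, Summable fun n => ‖a n • y n‖ := fun a => by
    have ha : Summable fun n => ‖a n‖ := by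
      simpa using (lp.memℓp a).summable (by norm_num)
    refine Summable.of_nonneg_of_le (fun _ => norm_nonneg _) (fun n => ?_) (ha.mul_right C)
    rw [norm_smul]
    gcongr
    exact hy n
  let T : lp (fun _ : ℕ => ℝ) 1 →ₗ[ℝ] Y :=
    { toFun := fun a => ∑' n, a n • y n
      map_add' := fun a b => by
        rw [← (hs a).of_norm.tsum_add (hs b).of_norm]
        simp [add_smul]
      map_smul' := fun c a => by
        rw [RingHom.id_apply, ← (hs a).of_norm.tsum_const_smul]
        simp [mul_smul] }
  refine ⟨T.mkContinuous C fun a => ?_, fun a => (hs a).of_norm.hasSum⟩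
  have ha : HasSum (fun n => ‖a n‖) ‖a‖ := by
    simpa using lp.hasSum_norm (p := 1) (by norm_num) a
  exact tsum_of_norm_bounded (ha.mul_left C) fun n => by
    rw [norm_smul, mul_comm]; gcongr; exact hy n

theorem apply_lp_single {Y : Type u} [NormedAddCommGroup Y] [NormedSpace ℝ Y] {y : ℕ → Y}
    {T : lp (fun _ : ℕ => ℝ) 1 →L[ℝ] Y} (hT : ∀ a, HasSum (fun n => a n • y n) (T a)) (k : ℕ) :
    T (lp.single 1 k 1) = y k := by
  refine (hT _).unique ?_
  convert hasSum_ite_eq k (y k) using 2 with n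
  by_cases h : n = k
  · subst h; simp
  · simp [h]

end

/-! ### Almost Grothendieck sets versus operators. -/

section AlmostGrothendieck

open BoundedContinuousFunction

variable {E : Type u} [NormedAddCommGroup E] [NormedSpace ℝ E] [Lattice E] [HasSolidNorm E]
  [IsOrderedAddMonoid E]

/-- The coordinate functional `c ↦ c n` on `c₀`. -/
noncomputable def ZeroAtInftyContinuousMap.coord (n : ℕ) : StrongDual ℝ C₀(ℕ, ℝ) :=
  LinearMap.mkContinuous
    { toFun := fun c => c n
      map_add' := fun _ _ => rfl
      map_smul' := fun _ _ => rfl } 1 fun c => by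
    rw [one_mul]; exact ZeroAtInftyContinuousMap.norm_apply_le c n

/-- Sequences `(φ, 0, 0, …)` make every rank-one map `x ↦ φ x • e₀` a disjoint operator, so almost
Grothendieck sets are weakly bounded, hence bounded. -/
theorem isDisjointSeq_single (φ : StrongDual ℝ E) :
    IsDisjointSeq (Pi.single (M := fun _ : ℕ => StrongDual ℝ E) 0 φ) := by
  have h0 : |(0 : StrongDual ℝ E)| = 0 := by simp [abs]
  have hp : ∀ ψ : StrongDual ℝ E, 0 ≤ |ψ| := fun ψ x hx => by
    have h1 : ψ x ≤ |ψ| x := (le_sup_left : ψ ≤ ψ ⊔ -ψ) x hx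
    have h2 : (-ψ) x ≤ |ψ| x := (le_sup_right : -ψ ≤ ψ ⊔ -ψ) x hx
    simp only [_root_.neg_apply, _root_.zero_apply] at *
    linarith
  intro m n hmn
  by_cases hm : m = 0
  · have hn : n ≠ 0 := fun hn => hmn (hm.trans hn.symm)
    rw [Pi.single_eq_of_ne hn, h0]
    exact inf_eq_right.2 (hp _)
  · rw [Pi.single_eq_of_ne hm, h0]
    exact inf_eq_left.2 (hp _)

theorem isWeakStarNull_single {Y : Type u} [NormedAddCommGroup Y] [NormedSpace ℝ Y]
    (φ : StrongDual ℝ Y) :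
    IsWeakStarNull (Pi.single (M := fun _ : ℕ => StrongDual ℝ Y) 0 φ) := by
  refine isWeakStarNull_iff.2 fun x => tendsto_const_nhds.congr' ?_
  filter_upwards [eventually_gt_atTop 0] with n hn
  rw [Pi.single_eq_of_ne hn.ne']
  rfl

theorem IsAlmostGrothendieckSet.isBounded [CompleteSpace E] {A : Set E}
    (hA : IsAlmostGrothendieckSet A) : Bornology.IsBounded A := by
  refine isBounded_of_forall_bddAbove fun φ => ?_
  obtain ⟨S, hS⟩ := exists_operator_of_isWeakStarNull (isWeakStarNull_single φ)
  have h := (hA S ⟨_, isWeakStarNull_single φ, isDisjointSeq_single φ, hS⟩).bddAbove_norm_apply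
    (ZeroAtInftyContinuousMap.coord 0)
  rw [Set.image_image] at h
  convert h using 4 with x
  exact (hS x 0).symm

theorem IsAlmostGrothendieckOperator.isAlmostGrothendieckSet_image {X : Type v}
    [NormedAddCommGroup X] [NormedSpace ℝ X] {T : X →L[ℝ] E}
    (hT : IsAlmostGrothendieckOperator T) :
    IsAlmostGrothendieckSet (T '' Metric.closedBall 0 1) := by
  rintro S ⟨f, hf, hd, hS⟩
  rw [Set.image_image]
  exact isWeaklyCompactOperator_of_isWeaklyNull (R := S.comp T) (g := fun n => (f n).comp T)
    (fun x n => hS (T x) n) (hT f hf hd)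

/-- The operator on `ℓ₁` sending the unit vectors to a sequence with relatively weakly compact
image under `S : E → c₀` pulls the coordinate functionals of `S` back to a weakly null sequence. -/
theorem isWeaklyNull_comp_of_isRelativelyWeaklyCompact {Y : Type u} [NormedAddCommGroup Y]
    [NormedSpace ℝ Y] {S : Y →L[ℝ] C₀(ℕ, ℝ)} {f : ℕ → StrongDual ℝ Y}
    (hS : ∀ x n, S x n = f n x) {A : Set Y} (hb : Bornology.IsBounded A)
    (hA : IsRelativelyWeaklyCompact (S '' A)) {y : ℕ → Y} (hy : ∀ k, y k ∈ A)
    {T : lp (fun _ : ℕ => ℝ) 1 →L[ℝ] Y} (hT : ∀ a, HasSum (fun n => a n • y n) (T a)) :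
    IsWeaklyNull fun n => (f n).comp T := by
  let K : Set (WeakSpace ℝ C₀(ℕ, ℝ)) := closure (toWeakSpace ℝ C₀(ℕ, ℝ) '' (S '' A))
  have : CompactSpace K := isCompact_iff_compactSpace.1 hA
  have hcont : ∀ n, Continuous fun w : WeakSpace ℝ C₀(ℕ, ℝ) =>
      ((toWeakSpace ℝ C₀(ℕ, ℝ)).symm w) n := fun n =>
    continuous_weakSpace_apply (ZeroAtInftyContinuousMap.coord n)
  let g : ℕ → K →ᵇ ℝ := fun n => mkOfCompact
    ⟨fun p => ((toWeakSpace ℝ C₀(ℕ, ℝ)).symm p) n, (hcont n).comp continuous_subtype_val⟩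
  let p : ℕ → K := fun k => ⟨toWeakSpace ℝ _ (S (y k)), subset_closure ⟨_, ⟨_, hy k, rfl⟩, rfl⟩⟩
  obtain ⟨M, hM⟩ := (S.lipschitz.isBounded_image hb).exists_norm_le
  have hM0 : 0 ≤ M := (norm_nonneg _).trans (hM _ ⟨_, hy 0, rfl⟩)
  have hg : IsWeaklyNull g := by
    refine isWeaklyNull_of_pointwise (C := M) (fun n => (norm_le hM0).2 fun q => ?_) fun q => ?_
    · refine closure_minimal (t := {w | ‖((toWeakSpace ℝ C₀(ℕ, ℝ)).symm w) n‖ ≤ M}) ?_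
        (isClosed_le (hcont n).norm continuous_const) q.2
      rintro _ ⟨c, hc, rfl⟩
      exact (ZeroAtInftyContinuousMap.norm_apply_le c n).trans (hM c hc)
    · have := ((toWeakSpace ℝ C₀(ℕ, ℝ)).symm q).zero_at_infty'
      rwa [cocompact_eq_cofinite, Nat.cofinite_eq_atTop] at this
  -- `V` sends the `k`-th unit vector to evaluation at `p k`. Its flip maps `h` to the functional
  -- with coefficients `h (p k)`; for `h = g n` these are `f n (y k)`.
  obtain ⟨V, hV⟩ := exists_operator_lp_one (Y := StrongDual ℝ (K →ᵇ ℝ))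
    (y := fun k => evalCLM ℝ (p k)) (C := 1) fun k =>
      ContinuousLinearMap.opNorm_le_bound _ zero_le_one fun h => by
        rw [one_mul]; exact h.norm_coe_le_norm _
  have hVg : ∀ n, V.flip (g n) = (f n).comp T := fun n => by
    ext a
    have h1 := (ContinuousLinearMap.apply ℝ ℝ (g n)).hasSum (hV a)
    have h2 := (f n).hasSum (hT a)
    refine HasSum.unique h1 (Eq.mp ?_ h2)
    congr 1
    ext k
    simp only [map_smul]
    rw [← hS]
    rfl
  rw [isWeaklyNull_iff] at hg ⊢
  intro φ
  exact (hg (φ.comp V.flip)).congr fun n => congrArg φ (hVg n)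

theorem isRelativelyWeaklyCompact_of_isAlmostGrothendieckSet [CompleteSpace E]
    (h : ∀ T : lp (fun _ : ℕ => ℝ) 1 →L[ℝ] E,
      IsAlmostGrothendieckOperator T → IsWeaklyCompactOperator T)
    {A : Set E} (hA : IsAlmostGrothendieckSet A) : IsRelativelyWeaklyCompact A := by
  refine isRelativelyWeaklyCompact_of_mapClusterPt hA.isBounded fun a ha => ?_
  obtain ⟨M, hM⟩ := hA.isBounded.exists_norm_le
  obtain ⟨T, hT⟩ := exists_operator_lp_one fun n => hM _ (ha n)
  have hTw : IsWeaklyCompactOperator T := h T fun f hf hd => by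
    obtain ⟨S, hS⟩ := exists_operator_of_isWeakStarNull hf
    exact isWeaklyNull_comp_of_isRelativelyWeaklyCompact hS hA.isBounded
      (hA S ⟨f, hf, hd, hS⟩) ha hT
  obtain ⟨w, -, hw⟩ := IsCompact.exists_clusterPt hTw
    (f := map (fun n => toWeakSpace ℝ E (a n)) atTop)
    (tendsto_principal.2 (Eventually.of_forall fun n => subset_closure
      ⟨a n, ⟨lp.single 1 n 1, by simp [lp.norm_single], apply_lp_single hT n⟩, rfl⟩))
  exact ⟨(toWeakSpace ℝ E).symm w, hw⟩

/-- Only universes are at stake: `ℓ₁` lives in `Type`, while assertion 2 ranges over `Type v`. -/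
theorem isWeaklyCompactOperator_of_ulift {X : Type}
    [NormedAddCommGroup X] [NormedSpace ℝ X]
    (h : ∀ T : ULift.{v} X →L[ℝ] E, IsAlmostGrothendieckOperator T → IsWeaklyCompactOperator T)
    {T : X →L[ℝ] E} (hT : IsAlmostGrothendieckOperator T) : IsWeaklyCompactOperator T := by
  let d : ULift.{v} X →L[ℝ] X := (ContinuousLinearEquiv.ulift : ULift.{v} X ≃L[ℝ] X)
  -- Precomposition with `d` is bounded between the duals, so it preserves weak nullity.
  have hd := h (T.comp d) fun f hf hdis => isWeaklyNull_iff.2 fun φ =>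
    isWeaklyNull_iff.1 (hT f hf hdis) (φ.comp ((ContinuousLinearMap.compL ℝ _ X ℝ).flip d))
  refine IsRelativelyWeaklyCompact.mono hd ?_
  rintro _ ⟨x, hx, rfl⟩
  refine ⟨ULift.up x, ?_, rfl⟩
  rw [mem_closedBall_zero_iff] at hx ⊢
  exact hx

end AlmostGrothendieck

theorem mainTheorem5 {E : Type u} [NormedAddCommGroup E] [NormedSpace ℝ E] [CompleteSpace E]
    [Lattice E] [HasSolidNorm E] [IsOrderedAddMonoid E] [IsOrderedModule ℝ E] :
    List.TFAE [
      ∀ A : Set E, IsAlmostGrothendieckSet A → IsRelativelyWeaklyCompact A,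
      ∀ (X : Type v) [NormedAddCommGroup X] [NormedSpace ℝ X] [CompleteSpace X]
        (T : X →L[ℝ] E), IsAlmostGrothendieckOperator T → IsWeaklyCompactOperator T,
      ∀ T : lp (fun _ : ℕ => ℝ) 1 →L[ℝ] E,
        IsAlmostGrothendieckOperator T → IsWeaklyCompactOperator T] := by
  tfae_have 1 → 2 := fun h X _ _ _ T hT => h _ hT.isAlmostGrothendieckSet_image
  tfae_have 2 → 3 := fun h T hT =>
    isWeaklyCompactOperator_of_ulift (h (ULift.{v} (lp (fun _ : ℕ => ℝ) 1))) hT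
  tfae_have 3 → 1 := fun h A hA => isRelativelyWeaklyCompact_of_isAlmostGrothendieckSet h hA
  tfae_finish
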